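/- Let $(R,\mathfrak m)$ be a complete Noetherian local (commutative) ring. An \emph{interior operation} $\mathrm i$ on Artinian $R$-modules assigns to every Artinian $R$-module $M$ a submodule $\mathrm i(M)\subseteq M$ such that $\varphi(\mathrm i(M))=\mathrm i(N)$ for every isomorphism $\varphi\colon M\to N$ of Artinian modules, $\mathrm i(L)\subseteq \mathrm i(M)$ whenever $L\subseteq M$, and $\mathrm i(\mathrm i(M))=\mathrm i(M)$. It is called \emph{Nakayama} if, for all Artinian $R$-modules $A\subseteq B$, the inclusion $\mathrm i(A:_B\mathfrak m)\subseteq A$ implies $\mathrm i(A)=\mathrm i(B)$, where $(A:_B\mathfrak m)=\{b\in B : \mathfrak m b\subseteq A\}$. For Artinian $R$-modules $A\subseteq B$, an \emph{$\mathrm i$-expansion of $A$ in $B$} is a submodule $C$ with $A\subseteq C\subseteq B$ and $\mathrm i(A)=\mathrm i(C)$; it is \emph{maximal} if it is not strictly contained in another $\mathrm i$-expansion of $A$ in $B$. Let $A\subseteq B$ be Artinian $R$-modules and let $\mathrm i$ be a Nakayama interior operation on Artinian $R$-modules. Then maximal $\mathrm i$-expansions of $A$ in $B$ exist. In fact, for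 every $\mathrm i$-expansion $C$ of $A$ in $B$ there is a maximal $\mathrm i$-expansion $D$ of $A$ in $B$ with $A\subseteq C\subseteq D\subseteq B$. -/

import Mathlib

universe u v

/-- A submodule selector on the class of Artinian `R`-modules: it assigns to every Artinian module
`M` a submodule of `M`, compatibly with all isomorphisms of Artinian modules. -/
structure ArtinianSubmoduleSelector (R : Type u) [CommRing R] : Type (max u (v + 1)) where
  /-- the selected submodule of an Artinian module -/
  sel : ∀ (M : Type v) [AddCommGroup M] [Module R M] [IsArtinian R M], Submodule R M
  /-- compatibility with isomorphisms -/
  map_sel : ∀ (M N : Type v) [AddCommGroup M] [Module R M] [IsArtinian R M]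
    [AddCommGroup N] [Module R N] [IsArtinian R N] (φ : M ≃ₗ[R] N),
    (sel M).map φ.toLinearMap = sel N

namespace ArtinianSubmoduleSelector

variable {R : Type u} [CommRing R]

/-- `α.on L` is `α(L)` for a submodule `L` of an Artinian module `B`: the selector applied to `L`
as a module in its own right, the result being regarded as a submodule of `B`. -/
def on (α : ArtinianSubmoduleSelector.{u, v} R) {B : Type v} [AddCommGroup B] [Module R B]
    [IsArtinian R B] (L : Submodule R B) : Submodule R B :=
  (α.sel L).map L.subtype

end ArtinianSubmoduleSelector

/-- An interior operation on the class of Artinian `R`-modules: a submodule selector that is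
order-preserving and idempotent. -/
structure ArtinianInterior (R : Type u) [CommRing R] : Type (max u (v + 1)) extends
    ArtinianSubmoduleSelector.{u, v} R where
  /-- `α(L) ⊆ α(M)` for `L ⊆ M` -/
  on_le_sel : ∀ (M : Type v) [AddCommGroup M] [Module R M] [IsArtinian R M] (L : Submodule R M),
    toArtinianSubmoduleSelector.on L ≤ sel M
  /-- `α(α(M)) = α(M)` -/
  on_sel : ∀ (M : Type v) [AddCommGroup M] [Module R M] [IsArtinian R M],
    toArtinianSubmoduleSelector.on (sel M) = sel M

/-- The submodule `(A :_B I) = {b ∈ B | I b ⊆ A}` of `B`. -/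
def moduleColon {R : Type u} [CommRing R] {B : Type v} [AddCommGroup B] [Module R B]
    (A : Submodule R B) (I : Ideal R) : Submodule R B where
  carrier := {b | ∀ r ∈ I, r • b ∈ A}
  add_mem' := fun {a b} ha hb r hr => by
    rw [smul_add]
    exact A.add_mem (ha r hr) (hb r hr)
  zero_mem' := fun r _ => by
    rw [smul_zero]
    exact A.zero_mem
  smul_mem' := fun c x hx r hr => by
    rw [smul_comm]
    exact A.smul_mem c (hx r hr)

namespace ArtinianInterior

variable {R : Type u} [CommRing R]

/-- An interior operation `i` on Artinian modules over a local ring `(R, 𝔪)` is Nakayama if, for all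
Artinian modules `A ⊆ B`, `i(A :_B 𝔪) ⊆ A` implies `i(A) = i(B)`. -/
def IsNakayama [IsLocalRing R] (i : ArtinianInterior.{u, v} R) : Prop :=
  ∀ (B : Type v) [AddCommGroup B] [Module R B] [IsArtinian R B] (A : Submodule R B),
    i.on (moduleColon A (IsLocalRing.maximalIdeal R)) ≤ A → i.on A = i.sel B

/-- `C` is an `i`-expansion of `A` in `B`: `A ⊆ C ⊆ B` and `i(A) = i(C)`. -/
def IsExpansion (i : ArtinianInterior.{u, v} R) {B : Type v} [AddCommGroup B] [Module R B]
    [IsArtinian R B] (A C : Submodule R B) : Prop :=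
  A ≤ C ∧ i.on A = i.on C

/-- `D` is a maximal `i`-expansion of `A` in `B`: it is an `i`-expansion of `A` in `B`, and no
`i`-expansion of `A` in `B` contains it strictly. -/
def IsMaximalExpansion (i : ArtinianInterior.{u, v} R) {B : Type v} [AddCommGroup B] [Module R B]
    [IsArtinian R B] (A D : Submodule R B) : Prop :=
  Maximal (i.IsExpansion A) D

end ArtinianInterior

/-! By Zorn's lemma it is enough that the union `U` of a nonempty chain of expansions of `A` is an
expansion. The Nakayama property, applied to `A ⊆ U`, reduces this to `i(U ∩ (A :_B 𝔪)) ⊆ A`. Now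
`(A :_B 𝔪) / A` is an Artinian vector space over `R/𝔪`, hence finite-dimensional, so the traces of
the chain on it stabilise and `U ∩ (A :_B 𝔪) ⊆ S` for a single member `S`. Monotonicity then gives
`i(U ∩ (A :_B 𝔪)) ⊆ i(S) = i(A) ⊆ A`. -/

/-- An Artinian module annihilated by a maximal ideal is Noetherian. -/
theorem Module.IsTorsionBySet.isNoetherian_of_isArtinian {R M : Type*} [CommRing R]
    [AddCommGroup M] [Module R M] [IsArtinian R M] {I : Ideal R} [hI : I.IsMaximal]
    (hM : Module.IsTorsionBySet R M I) : IsNoetherian R M := by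
  let _ := Ideal.Quotient.field I
  let _ := hM.module
  -- The identity of `M`, semilinear over `R → R/I`, transfers both chain conditions to a vector
  -- space, where they coincide.
  rw [hM.semilinearMap.isNoetherian_iff_of_bijective Function.bijective_id,
    IsSemiprimaryRing.isNoetherian_iff_isArtinian,
    ← hM.semilinearMap.isArtinian_iff_of_bijective Function.bijective_id]
  infer_instance

/-- If `B` is Artinian and `I` is maximal, then `(A :_B I) / A` is Noetherian. -/
theorem isNoetherian_map_mkQ_moduleColon {R B : Type*} [CommRing R] [AddCommGroup B] [Module R B]
    [IsArtinian R B] (A : Submodule R B) (I : Ideal R) [I.IsMaximal] :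
    IsNoetherian R ((moduleColon A I).map A.mkQ) := by
  refine Module.IsTorsionBySet.isNoetherian_of_isArtinian (I := I) ?_
  rintro ⟨_, b, hb, rfl⟩ ⟨r, hr⟩
  exact Subtype.ext ((Submodule.Quotient.mk_eq_zero A).2 (hb r hr))

/-- In a nonempty chain of submodules containing `A`, the traces on `(A :_B I)` have a largest
element. -/
theorem IsChain.exists_forall_inf_moduleColon_le {R B : Type*} [CommRing R] [AddCommGroup B]
    [Module R B] [IsArtinian R B] {A : Submodule R B} (I : Ideal R) [I.IsMaximal]
    {c : Set (Submodule R B)} (hc : IsChain (· ≤ ·) c) (hne : c.Nonempty)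
    (hA : ∀ S ∈ c, A ≤ S) :
    ∃ S ∈ c, ∀ S' ∈ c, S' ⊓ moduleColon A I ≤ S := by
  have := isNoetherian_map_mkQ_moduleColon A I
  let Q := (moduleColon A I).map A.mkQ
  let f : Submodule R B → Submodule R Q := fun S => (S.map A.mkQ).comap Q.subtype
  have hf : Monotone f := fun S S' h => Submodule.comap_mono (Submodule.map_mono h)
  obtain ⟨_, ⟨S, hS, rfl⟩, hmax⟩ := set_has_maximal_iff_noetherian.2 this (f '' c) (hne.image f)
  refine ⟨S, hS, fun S' hS' x hx => ?_⟩
  have hle : f S' ≤ f S := by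
    rcases hc.total hS hS' with h | h
    · exact ((hf h).eq_of_not_lt (hmax _ ⟨S', hS', rfl⟩)).ge
    · exact hf h
  have hxS : (⟨A.mkQ x, x, hx.2, rfl⟩ : Q) ∈ f S := hle ⟨x, hx.1, rfl⟩
  obtain ⟨y, hy, hyx⟩ := hxS
  -- Traces were compared only modulo `A`; since `A ≤ S`, nothing is lost.
  have hyx' : x - y ∈ A := (Submodule.Quotient.eq A).1 (Eq.symm hyx)
  simpa using S.add_mem (hA S hS hyx') hy

namespace ArtinianSubmoduleSelector

variable {R : Type u} [CommRing R] (α : ArtinianSubmoduleSelector.{u, v} R)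
  {B : Type v} [AddCommGroup B] [Module R B] [IsArtinian R B]

theorem on_le (L : Submodule R B) : α.on L ≤ L :=
  Submodule.map_subtype_le _ _

/-- Applying a selector to a submodule commutes with injective linear maps. -/
theorem map_on {E : Type v} [AddCommGroup E] [Module R E] [IsArtinian R E] (f : E →ₗ[R] B)
    (hf : Function.Injective f) (L : Submodule R E) : (α.on L).map f = α.on (L.map f) := by
  unfold on
  rw [← α.map_sel L (L.map f) (Submodule.equivMapOfInjective f hf L), ← Submodule.map_comp,
    ← Submodule.map_comp]
  rfl

/-- Changes the ambient module from `B` to `E`, so that axioms stated for a whole module apply to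
pairs of submodules of `B`. -/
theorem map_subtype_on_comap {L E : Submodule R B} (h : L ≤ E) :
    (α.on (L.comap E.subtype)).map E.subtype = α.on L := by
  rw [α.map_on _ E.injective_subtype, Submodule.map_comap_subtype, inf_eq_right.2 h]

end ArtinianSubmoduleSelector

namespace ArtinianInterior

variable {R : Type u} [CommRing R] (i : ArtinianInterior.{u, v} R)
  {B : Type v} [AddCommGroup B] [Module R B] [IsArtinian R B]

theorem on_mono {L E : Submodule R B} (h : L ≤ E) : i.on L ≤ i.on E := by
  rw [← i.map_subtype_on_comap h]
  exact Submodule.map_mono (i.on_le_sel E _)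

/-- The Nakayama property for a pair of submodules `A ≤ E` of an Artinian module. -/
theorem IsNakayama.on_eq_on [IsLocalRing R] {i : ArtinianInterior.{u, v} R} (hi : i.IsNakayama)
    {A E : Submodule R B} (hAE : A ≤ E)
    (h : i.on (E ⊓ moduleColon A (IsLocalRing.maximalIdeal R)) ≤ A) : i.on A = i.on E := by
  -- The colon formed inside `E` is the trace on `E` of the colon formed in `B`.
  have hcolon : moduleColon (A.comap E.subtype) (IsLocalRing.maximalIdeal R) =
      (E ⊓ moduleColon A (IsLocalRing.maximalIdeal R)).comap E.subtype := by
    ext x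
    exact ⟨fun hx => ⟨x.2, hx⟩, fun hx => hx.2⟩
  rw [← i.map_subtype_on_comap hAE, hi E (A.comap E.subtype)]
  · rfl
  · rw [hcolon, ← Submodule.map_le_iff_le_comap, i.map_subtype_on_comap inf_le_left]
    exact h

theorem IsNakayama.isExpansion_sSup [IsLocalRing R] {i : ArtinianInterior.{u, v} R}
    (hi : i.IsNakayama) {A : Submodule R B} {c : Set (Submodule R B)}
    (hc : IsChain (· ≤ ·) c) (hne : c.Nonempty) (hexp : ∀ S ∈ c, i.IsExpansion A S) :
    i.IsExpansion A (sSup c) := by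
  obtain ⟨S, hS, hmax⟩ := hc.exists_forall_inf_moduleColon_le (IsLocalRing.maximalIdeal R) hne
    fun S hS => (hexp S hS).1
  have hA : A ≤ sSup c := (hexp S hS).1.trans (le_sSup hS)
  refine ⟨hA, hi.on_eq_on hA ?_⟩
  have htrace : sSup c ⊓ moduleColon A (IsLocalRing.maximalIdeal R) ≤ S := by
    rintro x ⟨hx, hxA⟩
    obtain ⟨S', hS', hxS'⟩ := (Submodule.mem_sSup_of_directed hne hc.directedOn).1 hx
    exact hmax S' hS' ⟨hxS', hxA⟩
  calc i.on (sSup c ⊓ moduleColon A (IsLocalRing.maximalIdeal R)) ≤ i.on S := i.on_mono htrace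
    _ = i.on A := (hexp S hS).2.symm
    _ ≤ A := i.on_le A

theorem IsNakayama.exists_isMaximalExpansion_ge [IsLocalRing R] {i : ArtinianInterior.{u, v} R}
    (hi : i.IsNakayama) {A C : Submodule R B} (hC : i.IsExpansion A C) :
    ∃ D : Submodule R B, i.IsMaximalExpansion A D ∧ C ≤ D := by
  obtain ⟨D, hCD, hD⟩ := zorn_le_nonempty₀ {D | i.IsExpansion A D}
    (fun c hcs hc S hS => ⟨sSup c, hi.isExpansion_sSup hc ⟨S, hS⟩ hcs, fun _ => le_sSup⟩) C hC
  exact ⟨D, hD, hCD⟩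

end ArtinianInterior

theorem mainTheorem4 {R : Type u} [CommRing R] [IsLocalRing R] [IsNoetherianRing R]
    [IsAdicComplete (IsLocalRing.maximalIdeal R) R]
    (i : ArtinianInterior.{u, v} R) (hi : i.IsNakayama)
    {B : Type v} [AddCommGroup B] [Module R B] [IsArtinian R B] (A : Submodule R B) :
    (∃ D : Submodule R B, i.IsMaximalExpansion A D) ∧
      ∀ C : Submodule R B, i.IsExpansion A C →
        ∃ D : Submodule R B, i.IsMaximalExpansion A D ∧ C ≤ D :=
  ⟨(hi.exists_isMaximalExpansion_ge ⟨le_rfl, rfl⟩).imp fun _ => And.left,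
    fun _ => hi.exists_isMaximalExpansion_ge⟩
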